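/- Let $m,d,L\ge 2$ be integers. For $m$ parties $\mathsf A_1,\dots,\mathsf A_m$, each holding a qudit $\mathbb C^d$, let $\mathbb 1$ be the identity on $(\mathbb C^d)^{\otimes m}$, $\Psi_i=|i\cdots i\rangle\langle i\cdots i|$ for $i=0,\dots,d-1$, and $\Phi=\frac1d\sum_{i,j=0}^{d-1}|i\cdots i\rangle\langle j\cdots j|$ (the GHZ state). Let $\mathcal E=\{\eta_i,\rho_i\}_{i=1}^{d+2}$ be the ensemble $$\eta_i=\tfrac{1}{d^m+d},\ \rho_i=\Psi_{i-1}\ (1\le i\le d);\qquad \eta_{d+1}=\tfrac{d^m-d}{d^m+d},\ \rho_{d+1}=\tfrac{1}{d^m-d}\Big(\mathbb 1-\sum_{j=0}^{d-1}\Psi_j\Big);\qquad \eta_{d+2}=\tfrac{d}{d^m+d},\ \rho_{d+2}=\Phi .$$ Let $\mathcal E^{\otimes L}=\{\eta_{\vec c},\rho_{\vec c}\}$ be the sequence ensemble of $L$ copies of $\mathcal E$, where $\vec c\in\{1,\dots,d+2\}^L$, $\eta_{\vec c}=\prod_l\eta_{c_l}$, $\rho_{\vec c}=\bigotimes_l\rho_{c_l}$,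 and each party holds its $L$ qudits. For an ensemble $\mathcal F=\{\eta_x,\rho_x\}_x$ of $m$-party states let $p_{\sf G}(\mathcal F)$, $p_{\sf SEP}(\mathcal F)$ and $p_{\sf L}(\mathcal F)$ be the optimal value of $\sum_x\eta_x\operatorname{Tr}(\rho_xM_x)$ over all measurements $\{M_x\}$ (positive-semidefinite operators with sum the identity), over those whose operators are all separable (finite sums of tensor products of positive-semidefinite local operators), and over those that can be realized by finitely many rounds of local operations and classical communication (LOCC) among the parties. A Hermitian operator $E$ is block positive if $\operatorname{Tr}(E\sigma)\ge 0$ for every separable state $\sigma$. Put $$M_i=\Psi_{i-1}\ (1\le i\le d),\quad M_{d+1}=\mathbb 1-\sum_{j=0}^{d-1}\Psi_j,\quad M_{d+2}=0,\qquad M_{\vec c}=\bigotimes_{l=1}^L M_{c_l},\qquad H=\tfrac{1}{(d^m+d)^L}\,\mathbb 1^{\otimes L}.$$ Then: 1. $\rho_1,\dots,\rho_{d+1}$ are separable and $\rho_{d+2}$ is not. 2. $\{M_i\}$ is obtained by measuring every party in the computational basis and classically processing the results; $\{M_i\}$ and $\{M_{\vec c}\}$ are LOCC measurements. 3. $H$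 is Hermitian and, for every $\vec c$, $H-\eta_{\vec c}\rho_{\vec c}$ is block positive and $\operatorname{Tr}[M_{\vec c}(H-\eta_{\vec c}\rho_{\vec c})]=0$. 4. The optimal LOCC discrimination of $\mathcal E^{\otimes L}$ is factorizable and optimal among separable measurements: $p_{\sf L}(\mathcal E)^L=p_{\sf L}(\mathcal E^{\otimes L})=p_{\sf SEP}(\mathcal E^{\otimes L})$; the measurements $\{M_i\}$ and $\{M_{\vec c}\}$ attain $p_{\sf L}(\mathcal E)$ and $p_{\sf L}(\mathcal E^{\otimes L})$. 5. $\max_i\eta_i<p_{\sf L}(\mathcal E)=\frac{d^m}{d^m+d}<p_{\sf G}(\mathcal E)$. 6. $\max_{\vec c}\eta_{\vec c}<p_{\sf L}(\mathcal E^{\otimes L})<p_{\sf G}(\mathcal E^{\otimes L})$. -/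

import Mathlib

open scoped ComplexOrder Matrix

namespace SeqDisc

/-- The product operator `⨂ₖ B k` from `⨂ₖ ℂ^(X k)` to `⨂ₖ ℂ^(Y k)`, in the product basis. -/
def prodOp {m : ℕ} {X Y : Fin m → Type} (B : ∀ k, Matrix (Y k) (X k) ℂ) :
    Matrix (∀ k, Y k) (∀ k, X k) ℂ :=
  Matrix.of fun y x => ∏ k, B k (y k) (x k)

/-- The tensor product `⨂ₗ A l` of operators on `m`-party spaces `⨂ₖ ℂ^(X l k)`. It acts on the
`m`-party space in which party `k` holds `⨂ₗ ℂ^(X l k)`, its shares of all members of the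
sequence. -/
def seqOp {m L : ℕ} {X : Fin L → Fin m → Type}
    (A : ∀ l, Matrix (∀ k, X l k) (∀ k, X l k) ℂ) :
    Matrix (∀ k, ∀ l, X l k) (∀ k, ∀ l, X l k) ℂ :=
  Matrix.of fun a b => ∏ l, A l (fun k => a k l) (fun k => b k l)

/-- Separable operators: finite sums of positive-semidefinite product operators. -/
def IsSepOp {m : ℕ} {X : Fin m → Type} [∀ k, Fintype (X k)]
    (E : Matrix (∀ k, X k) (∀ k, X k) ℂ) : Prop :=
  ∃ (r : ℕ) (F : Fin r → ∀ k, Matrix (X k) (X k) ℂ),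
    (∀ s k, (F s k).PosSemidef) ∧ E = ∑ s, prodOp (F s)

/-- Block-positive operators: Hermitian, with nonnegative mean value on every separable state. -/
def IsBlockPositive {m : ℕ} {X : Fin m → Type} [∀ k, Fintype (X k)]
    (E : Matrix (∀ k, X k) (∀ k, X k) ℂ) : Prop :=
  E.IsHermitian ∧
    ∀ σ : Matrix (∀ k, X k) (∀ k, X k) ℂ, IsSepOp σ → σ.trace = 1 → 0 ≤ (E * σ).trace.re

/-- Measurements with outcome set `Ω` on a finite-dimensional space. -/
def IsMeasurement {V Ω : Type} [Fintype V] [DecidableEq V] [Fintype Ω]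
    (M : Ω → Matrix V V ℂ) : Prop :=
  (∀ i, (M i).PosSemidef) ∧ ∑ i, M i = 1

/-- Measurements that are realized by a finite protocol of local operations and classical
communication.

* `guess o`: without any further interaction, the outcome `o` is announced.
* `round k`: party `k` performs a local operation with Kraus operators `B a k`, broadcasts the
  result `a`, every other party `j` applies a local isometry `B a j` (for instance, it adjoins an
  ancilla, or does nothing), and the parties continue with an LOCC protocol, which may depend on
  `a`, for the measurement `N a`. The local dimensions may change in every round.

A local channel is a round whose result is not used in what follows; shared randomness is a round
with Kraus operators `√p_a • 1`; coarse-graining amounts to the same announcement at several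
leaves. -/
inductive IsLOCC {m : ℕ} {Ω : Type} [DecidableEq Ω] :
    ∀ (X : Fin m → Type) [∀ k, Fintype (X k)] [∀ k, DecidableEq (X k)],
      (Ω → Matrix (∀ k, X k) (∀ k, X k) ℂ) → Prop
  | guess (X : Fin m → Type) [∀ k, Fintype (X k)] [∀ k, DecidableEq (X k)] (o : Ω) :
      IsLOCC X (fun i => if i = o then 1 else 0)
  | round (X : Fin m → Type) [∀ k, Fintype (X k)] [∀ k, DecidableEq (X k)] (k : Fin m) (r : ℕ)
      (Y : Fin r → Fin m → Type) [∀ a j, Fintype (Y a j)] [∀ a j, DecidableEq (Y a j)]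
      (B : ∀ a j, Matrix (Y a j) (X j) ℂ)
      (kraus : ∑ a, (B a k)ᴴ * B a k = 1)
      (isometry : ∀ a j, j ≠ k → (B a j)ᴴ * B a j = 1)
      (N : ∀ a, Ω → Matrix (∀ j, Y a j) (∀ j, Y a j) ℂ)
      (next : ∀ a, IsLOCC (Y a) (N a)) :
      IsLOCC X (fun i => ∑ a, (prodOp (B a))ᴴ * N a i * prodOp (B a))

/-- Ensembles `{η i, ρ i}` of states of an `m`-party system, with nonzero probabilities. -/
structure Ensemble {m : ℕ} (X : Fin m → Type) [∀ k, Fintype (X k)] (Ω : Type) [Fintype Ω] where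
  η : Ω → ℝ
  ρ : Ω → Matrix (∀ k, X k) (∀ k, X k) ℂ
  η_pos : ∀ i, 0 < η i
  η_sum : ∑ i, η i = 1
  ρ_posSemidef : ∀ i, (ρ i).PosSemidef
  ρ_trace : ∀ i, (ρ i).trace = 1

namespace Ensemble

variable {m : ℕ} {X : Fin m → Type} [∀ k, Fintype (X k)] [∀ k, DecidableEq (X k)]
  {Ω : Type} [Fintype Ω] [DecidableEq Ω]

/-- The average probability of guessing the prepared state correctly by the measurement `M`. -/
noncomputable def success (E : Ensemble X Ω) (M : Ω → Matrix (∀ k, X k) (∀ k, X k) ℂ) : ℝ :=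
  ∑ i, E.η i * (E.ρ i * M i).trace.re

/-- The optimal success probability over all measurements. -/
noncomputable def pG (E : Ensemble X Ω) : ℝ :=
  sSup {p | ∃ M, IsMeasurement M ∧ p = E.success M}

/-- The optimal success probability over separable measurements. -/
noncomputable def pSEP (E : Ensemble X Ω) : ℝ :=
  sSup {p | ∃ M, IsMeasurement M ∧ (∀ i, IsSepOp (M i)) ∧ p = E.success M}

/-- The optimal success probability over LOCC measurements. -/
noncomputable def pL (E : Ensemble X Ω) : ℝ :=
  sSup {p | ∃ M, IsMeasurement M ∧ IsLOCC X M ∧ p = E.success M}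

end Ensemble

theorem seqOp_posSemidef {m L : ℕ} {X : Fin L → Fin m → Type} [∀ l k, Fintype (X l k)]
    (A : ∀ l, Matrix (∀ k, X l k) (∀ k, X l k) ℂ) (hA : ∀ l, (A l).PosSemidef) :
    (seqOp A).PosSemidef := by
  classical
  have h : ∀ l, ∃ B : Matrix (∀ k, X l k) (∀ k, X l k) ℂ, A l = Bᴴ * B := fun l =>
    by
    open scoped MatrixOrder in
    exact CStarAlgebra.nonneg_iff_eq_star_mul_self.mp (hA l).nonneg
  choose B hB using h
  have key : seqOp A = (seqOp B)ᴴ * seqOp B := by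
    ext a b
    simp only [seqOp, Matrix.of_apply, Matrix.mul_apply, Matrix.conjTranspose_apply, hB,
      Finset.prod_univ_sum, Fintype.piFinset_univ, star_prod, ← Finset.prod_mul_distrib]
    exact Fintype.sum_equiv (Equiv.piComm _) _ _ (fun _ => rfl)
  rw [key]
  exact Matrix.posSemidef_conjTranspose_mul_self _

theorem seqOp_trace {m L : ℕ} {X : Fin L → Fin m → Type} [∀ l k, Fintype (X l k)]
    (A : ∀ l, Matrix (∀ k, X l k) (∀ k, X l k) ℂ) :
    (seqOp A).trace = ∏ l, (A l).trace := by
  classical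
  simp only [seqOp, Matrix.trace, Matrix.diag_apply, Matrix.of_apply, Finset.prod_univ_sum,
    Fintype.piFinset_univ]
  exact Fintype.sum_equiv (Equiv.piComm _) _ _ (fun _ => rfl)

/-- The sequence ensemble `⨂ₗ E l = {η_c, ρ_c}`, with `η_c = ∏ₗ η_{c l}` and `ρ_c = ⨂ₗ ρ_{c l}`. -/
def Ensemble.seq {m L : ℕ} {X : Fin L → Fin m → Type} [∀ l k, Fintype (X l k)]
    {Ω : Fin L → Type} [∀ l, Fintype (Ω l)] (E : ∀ l, Ensemble (X l) (Ω l)) :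
    Ensemble (fun k => ∀ l, X l k) (∀ l, Ω l) where
  η c := ∏ l, (E l).η (c l)
  ρ c := seqOp fun l => (E l).ρ (c l)
  η_pos c := Finset.prod_pos fun l _ => (E l).η_pos (c l)
  η_sum := by
    have h := Finset.prod_univ_sum (fun l => (Finset.univ : Finset (Ω l))) (fun l => (E l).η)
    rw [Fintype.piFinset_univ] at h
    rw [← h]
    exact Finset.prod_eq_one fun l _ => (E l).η_sum
  ρ_posSemidef c := seqOp_posSemidef _ fun l => (E l).ρ_posSemidef (c l)
  ρ_trace c := by
    rw [seqOp_trace]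
    exact Finset.prod_eq_one fun l _ => (E l).ρ_trace (c l)

/-- The optimal LOCC discrimination of `⨂ₗ E l` is factorizable. -/
def Factorizable {m L : ℕ} {X : Fin L → Fin m → Type} [∀ l k, Fintype (X l k)]
    [∀ l k, DecidableEq (X l k)] {Ω : Fin L → Type} [∀ l, Fintype (Ω l)]
    [∀ l, DecidableEq (Ω l)] (E : ∀ l, Ensemble (X l) (Ω l)) : Prop :=
  (Ensemble.seq E).pL = ∏ l, (E l).pL

/-- The vector `|i⋯i⟩` of `m` qudits. -/
def diagKet (m d : ℕ) (i : Fin d) : (Fin m → Fin d) → ℂ :=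
  Pi.single (fun _ => i) 1

/-- The projector `Ψ_i = |i⋯i⟩⟨i⋯i|`. -/
def Psi (m d : ℕ) (i : Fin d) : Matrix (Fin m → Fin d) (Fin m → Fin d) ℂ :=
  Matrix.vecMulVec (diagKet m d i) (star (diagKet m d i))

/-- The GHZ vector `d^(-1/2) ∑ᵢ |i⋯i⟩`. -/
noncomputable def ghzKet (m d : ℕ) : (Fin m → Fin d) → ℂ :=
  ((1 / Real.sqrt d : ℝ) : ℂ) • ∑ i, diagKet m d i

/-- The GHZ state `Φ`. -/
noncomputable def Phi (m d : ℕ) : Matrix (Fin m → Fin d) (Fin m → Fin d) ℂ :=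
  Matrix.vecMulVec (ghzKet m d) (star (ghzKet m d))

/-- The prior probabilities of the example; the label `i` stands for `i + 1` in `1, …, d + 2`. -/
noncomputable def exProb (m d : ℕ) (i : Fin (d + 2)) : ℝ :=
  if i.val < d then 1 / ((d : ℝ) ^ m + d)
  else if i.val = d then ((d : ℝ) ^ m - d) / ((d : ℝ) ^ m + d)
  else d / ((d : ℝ) ^ m + d)

/-- The states of the example. -/
noncomputable def exState (m d : ℕ) (i : Fin (d + 2)) :
    Matrix (Fin m → Fin d) (Fin m → Fin d) ℂ :=
  if h : i.val < d then Psi m d ⟨i.val, h⟩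
  else if i.val = d then (1 / ((d : ℝ) ^ m - d)) • (1 - ∑ j, Psi m d j)
  else Phi m d

/-- The measurement of the example. -/
def exMeas (m d : ℕ) (i : Fin (d + 2)) : Matrix (Fin m → Fin d) (Fin m → Fin d) ℂ :=
  if h : i.val < d then Psi m d ⟨i.val, h⟩
  else if i.val = d then 1 - ∑ j, Psi m d j
  else 0

theorem lt_pow_of_two_le {m d : ℕ} (hm : 2 ≤ m) (hd : 2 ≤ d) : (d : ℝ) < (d : ℝ) ^ m := by
  have h : d ^ 1 < d ^ m := Nat.pow_lt_pow_right (by omega) (by omega)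
  rw [pow_one] at h
  exact_mod_cast h

theorem trace_Psi (m d : ℕ) (i : Fin d) : (Psi m d i).trace = 1 := by
  rw [Psi, Matrix.trace_vecMulVec]
  simp [diagKet]

theorem sum_Psi_eq {m d : ℕ} (hm : 2 ≤ m) :
    ∑ j, Psi m d j =
      Matrix.diagonal fun x : Fin m → Fin d => if ∃ j, x = fun _ => j then (1 : ℂ) else 0 := by
  ext x y
  rw [Matrix.sum_apply, Matrix.diagonal_apply]
  simp only [Psi, diagKet, Matrix.vecMulVec_apply, Pi.star_apply, Pi.single_apply]
  by_cases hx : ∃ j, x = fun _ => j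
  · obtain ⟨j, rfl⟩ := hx
    have hj : ∀ i : Fin d, ((fun _ : Fin m => j) = fun _ => i) ↔ j = i := fun i =>
      ⟨fun h => congrFun h ⟨0, by omega⟩, fun h => by rw [h]⟩
    have hy : ∀ i : Fin d, (if j = i then (1 : ℂ) else 0) * star (if y = fun _ => i then (1 : ℂ)
        else 0) = if j = i then (if y = fun _ => j then 1 else 0) else 0 := by
      intro i
      by_cases h : j = i
      · subst h
        split_ifs <;> simp
      · simp [h]
    simp only [hj, hy, Finset.sum_ite_eq, Finset.mem_univ, if_true]
    simp [eq_comm (a := y)]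
  · have hx' : ∀ i, ¬ x = fun _ => i := fun i h => hx ⟨i, h⟩
    simp [hx']

theorem trace_complement {m d : ℕ} :
    (1 - ∑ j, Psi m d j).trace = (((d : ℝ) ^ m - d : ℝ) : ℂ) := by
  simp [Matrix.trace_sub, Matrix.trace_sum, trace_Psi]

theorem posSemidef_complement {m d : ℕ} (hm : 2 ≤ m) : (1 - ∑ j, Psi m d j).PosSemidef := by
  rw [sum_Psi_eq hm, ← Matrix.diagonal_one, Matrix.diagonal_sub]
  refine Matrix.PosSemidef.diagonal fun x => ?_
  by_cases h : ∃ j, x = fun _ => j <;> simp [h]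

theorem trace_Phi {m d : ℕ} (hm : 2 ≤ m) (hd : 2 ≤ d) : (Phi m d).trace = 1 := by
  have h0 : (d : ℝ) ≠ 0 := by positivity
  have hs : (∑ i, diagKet m d i) ⬝ᵥ star (∑ i, diagKet m d i) = (d : ℂ) := by
    have hj : ∀ i j : Fin d, ((fun _ : Fin m => j) = fun _ => i) ↔ j = i := fun i j =>
      ⟨fun h => congrFun h ⟨0, by omega⟩, fun h => by rw [h]⟩
    simp [star_sum, dotProduct_sum, diagKet, Pi.single_apply, hj]
  rw [Phi, Matrix.trace_vecMulVec, ghzKet, star_smul, smul_dotProduct, dotProduct_smul, hs]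
  have hq : (1 / Real.sqrt d) * (1 / Real.sqrt d) * (d : ℝ) = 1 := by
    rw [div_mul_div_comm, Real.mul_self_sqrt (by positivity)]
    field_simp
  have hq' := congrArg (fun t : ℝ => (t : ℂ)) hq
  simpa [mul_assoc] using hq'

/-- The ensemble of the example. -/
noncomputable def exEnsemble (m d : ℕ) (hm : 2 ≤ m) (hd : 2 ≤ d) :
    Ensemble (fun _ : Fin m => Fin d) (Fin (d + 2)) where
  η := exProb m d
  ρ := exState m d
  η_pos i := by
    have h := lt_pow_of_two_le hm hd
    have hd0 : (0 : ℝ) < d := by positivity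
    unfold exProb
    split_ifs
    · positivity
    · exact div_pos (by linarith) (by positivity)
    · positivity
  η_sum := by
    have h0 : (d : ℝ) ^ m + d ≠ 0 := by positivity
    rw [Fin.sum_univ_castSucc, Fin.sum_univ_castSucc]
    simp [exProb]
    field_simp
    ring
  ρ_posSemidef i := by
    have h := lt_pow_of_two_le hm hd
    unfold exState
    split_ifs
    · exact Matrix.posSemidef_vecMulVec_self_star _
    · exact (posSemidef_complement hm).smul (one_div_nonneg.mpr (by linarith))
    · exact Matrix.posSemidef_vecMulVec_self_star _
  ρ_trace i := by
    have h := lt_pow_of_two_le hm hd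
    have h' : (((d : ℝ) ^ m - d : ℝ) : ℂ) ≠ 0 := by
      exact_mod_cast (sub_pos.mpr h).ne'
    unfold exState
    split_ifs
    · exact trace_Psi _ _ _
    · rw [Matrix.trace_smul, trace_complement, Complex.real_smul, Complex.ofReal_div,
        Complex.ofReal_one, one_div, inv_mul_cancel₀ h']
    · exact trace_Phi hm hd

/-- The sequence ensemble of the example: `L` identical copies of the ensemble. -/
noncomputable def exSeq (m d L : ℕ) (hm : 2 ≤ m) (hd : 2 ≤ d) :
    Ensemble (fun _ : Fin m => Fin L → Fin d) (Fin L → Fin (d + 2)) :=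
  Ensemble.seq fun _ : Fin L => exEnsemble m d hm hd

/-- The measurement `M_c = ⨂ₗ M_{c l}`: the measurement of the example is performed at each step. -/
def exSeqMeas (m d L : ℕ) (c : Fin L → Fin (d + 2)) :
    Matrix (Fin m → Fin L → Fin d) (Fin m → Fin L → Fin d) ℂ :=
  seqOp fun l => exMeas m d (c l)

/-- The operator `H = (d^m + d)^(-L) 𝟙 ⊗ ⋯ ⊗ 𝟙`. -/
noncomputable def exH (m d L : ℕ) : Matrix (Fin m → Fin L → Fin d) (Fin m → Fin L → Fin d) ℂ :=
  (1 / ((d : ℝ) ^ m + d) ^ L) •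
    seqOp fun _ : Fin L => (1 : Matrix (Fin m → Fin d) (Fin m → Fin d) ℂ)

end SeqDisc

open SeqDisc

/-! Set `D = d^m + d`. The weighted operators `W_i = D η_i ρ_i` (`exWeighted`) are the `M_i`
themselves, except that the last one is `d Φ`. Everything follows from `Tr (W_c σ) ≤ Tr σ` for
separable `σ`, where `W_c` is the tensor product of the `W_{c l}`.

Block positivity need not survive tensor products, so a stronger property is carried along: the
partial transpose of `W_i` at one fixed party is symmetric, entrywise nonnegative and has row sums
at most `1` (`IsSubstochasticAt`). For the `M_i` it is a 0-1 diagonal matrix, for `d Φ` a partial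
permutation. The property passes to tensor products (`IsSubstochasticAt.seqOp`) and puts the partial
transpose below the identity (`posSemidef_one_sub_of_rowSum_le`). Separable operators have positive
partial transpose and `Tr (A B)` is unchanged when both factors are partially transposed, so the
trace bound follows.

Summed over a separable measurement, the bound gives success at most `(d^m / D)^L`. Since `M_i W_i =
M_i`, the product measurement attains it; it is LOCC, and LOCC operators are separable
(`IsLOCC.isSepOp`), so the LOCC and separable optima coincide and factorize. A global measurement
detecting `Φ` does strictly better in one step, hence its repetition does so on the sequence. -/

namespace SeqDisc

/-! ### Products of local operators -/

section ProductOperators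

variable {m : ℕ} {X Y Z : Fin m → Type}

theorem prodOp_mul [∀ k, Fintype (Y k)] (A : ∀ k, Matrix (Z k) (Y k) ℂ)
    (B : ∀ k, Matrix (Y k) (X k) ℂ) :
    prodOp A * prodOp B = prodOp fun k => A k * B k := by
  ext z x
  simp only [prodOp, Matrix.mul_apply, Matrix.of_apply, ← Finset.prod_mul_distrib,
    Finset.prod_univ_sum, Fintype.piFinset_univ]

theorem prodOp_conjTranspose (B : ∀ k, Matrix (Y k) (X k) ℂ) :
    (prodOp B)ᴴ = prodOp fun k => (B k)ᴴ := by
  ext x y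
  simp [prodOp, Matrix.conjTranspose_apply]

theorem prodOp_diagonal [∀ k, DecidableEq (X k)] (v : ∀ k, X k → ℂ) :
    prodOp (fun k => Matrix.diagonal (v k)) = Matrix.diagonal fun x => ∏ k, v k (x k) := by
  ext x y
  rw [prodOp, Matrix.of_apply]
  by_cases h : x = y
  · subst h
    simp
  · obtain ⟨k, hk⟩ := Function.ne_iff.mp h
    rw [Matrix.diagonal_apply_ne _ h]
    exact Finset.prod_eq_zero (Finset.mem_univ k) (Matrix.diagonal_apply_ne _ hk)

theorem prodOp_one [∀ k, DecidableEq (X k)] :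
    prodOp (fun k => (1 : Matrix (X k) (X k) ℂ)) = 1 := by
  simp only [← Matrix.diagonal_one, prodOp_diagonal, Finset.prod_const_one]

theorem prodOp_single [∀ k, DecidableEq (X k)] (x : ∀ k, X k) :
    prodOp (fun k => Matrix.single (x k) (x k) (1 : ℂ)) = Matrix.diagonal (Pi.single x 1) := by
  have h : ∀ k, Matrix.single (x k) (x k) (1 : ℂ) = Matrix.diagonal (Pi.single (x k) 1) :=
    fun k => (Matrix.diagonal_single _ _).symm
  simp only [h, prodOp_diagonal]
  congr 1
  ext y
  simp only [Pi.single_apply]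
  rw [Fintype.prod_ite_zero]
  simp [funext_iff]

theorem prodOp_posSemidef [∀ k, Fintype (X k)] (A : ∀ k, Matrix (X k) (X k) ℂ)
    (hA : ∀ k, (A k).PosSemidef) : (prodOp A).PosSemidef := by
  classical
  have h : ∀ k, ∃ B : Matrix (X k) (X k) ℂ, A k = Bᴴ * B := fun k => by
    open scoped MatrixOrder in
    exact CStarAlgebra.nonneg_iff_eq_star_mul_self.mp (hA k).nonneg
  choose B hB using h
  have key : prodOp A = (prodOp B)ᴴ * prodOp B := by
    rw [prodOp_conjTranspose, prodOp_mul]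
    exact congrArg prodOp (funext hB)
  rw [key]
  exact Matrix.posSemidef_conjTranspose_mul_self _

end ProductOperators

/-! ### Tensor products over the steps of a sequence -/

section SequenceOperators

variable {m L : ℕ} {X : Fin L → Fin m → Type}

theorem seqOp_mul [∀ l k, Fintype (X l k)] (A B : ∀ l, Matrix (∀ k, X l k) (∀ k, X l k) ℂ) :
    seqOp A * seqOp B = seqOp fun l => A l * B l := by
  classical
  ext a b
  simp only [seqOp, Matrix.of_apply, Matrix.mul_apply, Finset.prod_univ_sum,
    Fintype.piFinset_univ, ← Finset.prod_mul_distrib]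
  -- An index is listed by steps on one side and by parties on the other; `Equiv.piComm` exchanges
  -- the two.
  exact Fintype.sum_equiv (Equiv.piComm _) _ _ (fun _ => rfl)

theorem seqOp_diagonal [∀ l k, DecidableEq (X l k)] (v : ∀ l, (∀ k, X l k) → ℂ) :
    seqOp (fun l => Matrix.diagonal (v l)) =
      Matrix.diagonal fun x => ∏ l, v l fun k => x k l := by
  ext x y
  rw [seqOp, Matrix.of_apply]
  by_cases h : x = y
  · subst h
    simp
  · obtain ⟨k, hk⟩ := Function.ne_iff.mp h
    obtain ⟨l, hl⟩ := Function.ne_iff.mp hk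
    rw [Matrix.diagonal_apply_ne _ h]
    exact Finset.prod_eq_zero (Finset.mem_univ l)
      (Matrix.diagonal_apply_ne _ fun e => hl (congrFun e k))

theorem seqOp_one [∀ l k, DecidableEq (X l k)] :
    seqOp (fun l => (1 : Matrix (∀ k, X l k) (∀ k, X l k) ℂ)) = 1 := by
  simp only [← Matrix.diagonal_one, seqOp_diagonal, Finset.prod_const_one]

theorem seqOp_smul (r : Fin L → ℝ) (A : ∀ l, Matrix (∀ k, X l k) (∀ k, X l k) ℂ) :
    seqOp (fun l => r l • A l) = (∏ l, r l) • seqOp A := by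
  ext a b
  simp [seqOp, Finset.prod_mul_distrib]

theorem sum_seqOp {Ω : Fin L → Type} [∀ l, Fintype (Ω l)]
    (M : ∀ l, Ω l → Matrix (∀ k, X l k) (∀ k, X l k) ℂ) :
    ∑ c : ∀ l, Ω l, seqOp (fun l => M l (c l)) = seqOp fun l => ∑ i, M l i := by
  classical
  ext a b
  simp only [seqOp, Matrix.sum_apply, Matrix.of_apply, Finset.prod_univ_sum,
    Fintype.piFinset_univ]

theorem IsMeasurement.seq [∀ l k, Fintype (X l k)] [∀ l k, DecidableEq (X l k)]
    {Ω : Fin L → Type} [∀ l, Fintype (Ω l)]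
    {M : ∀ l, Ω l → Matrix (∀ k, X l k) (∀ k, X l k) ℂ} (hM : ∀ l, IsMeasurement (M l)) :
    IsMeasurement fun c : ∀ l, Ω l => seqOp fun l => M l (c l) := by
  refine ⟨fun c => seqOp_posSemidef _ fun l => (hM l).1 (c l), ?_⟩
  rw [sum_seqOp]
  simp only [(hM _).2, seqOp_one]

end SequenceOperators

/-! ### The cone of separable operators -/

section Separable

variable {m : ℕ} {X Y : Fin m → Type} [∀ k, Fintype (X k)] [∀ k, Fintype (Y k)]

theorem IsSepOp.prodOp {F : ∀ k, Matrix (X k) (X k) ℂ} (hF : ∀ k, (F k).PosSemidef) :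
    IsSepOp (prodOp F) :=
  ⟨1, fun _ => F, fun _ => hF, by simp⟩

theorem IsSepOp.zero : IsSepOp (0 : Matrix (∀ k, X k) (∀ k, X k) ℂ) :=
  ⟨0, fun s => s.elim0, fun s => s.elim0, by simp⟩

theorem IsSepOp.add {A B : Matrix (∀ k, X k) (∀ k, X k) ℂ} (hA : IsSepOp A) (hB : IsSepOp B) :
    IsSepOp (A + B) := by
  obtain ⟨r, F, hF, rfl⟩ := hA
  obtain ⟨s, G, hG, rfl⟩ := hB
  refine ⟨r + s, Fin.append F G, fun i => ?_, by simp [Fin.sum_univ_add]⟩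
  induction i using Fin.addCases with
  | left i => simpa using hF i
  | right i => simpa using hG i

theorem IsSepOp.sum {ι : Type*} (s : Finset ι) {A : ι → Matrix (∀ k, X k) (∀ k, X k) ℂ}
    (hA : ∀ i ∈ s, IsSepOp (A i)) : IsSepOp (∑ i ∈ s, A i) := by
  classical
  induction s using Finset.induction_on with
  | empty => simpa using IsSepOp.zero
  | insert i s hi ih =>
    rw [Finset.sum_insert hi]
    exact (hA i (Finset.mem_insert_self i s)).add
      (ih fun j hj => hA j (Finset.mem_insert_of_mem hj))

theorem IsSepOp.conj {N : Matrix (∀ k, Y k) (∀ k, Y k) ℂ} (hN : IsSepOp N)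
    (B : ∀ k, Matrix (Y k) (X k) ℂ) :
    IsSepOp ((SeqDisc.prodOp B)ᴴ * N * SeqDisc.prodOp B) := by
  obtain ⟨r, F, hF, rfl⟩ := hN
  refine ⟨r, fun s k => (B k)ᴴ * F s k * B k,
    fun s k => (hF s k).conjTranspose_mul_mul_same (B k), ?_⟩
  rw [Matrix.mul_sum, Matrix.sum_mul]
  simp only [prodOp_conjTranspose, prodOp_mul]

theorem IsSepOp.one [∀ k, DecidableEq (X k)] :
    IsSepOp (1 : Matrix (∀ k, X k) (∀ k, X k) ℂ) := by
  rw [← prodOp_one]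
  exact IsSepOp.prodOp fun _ => Matrix.PosSemidef.one

/-- The scalar is absorbed into the factor of a single party. Without parties, every product
operator is `1` and only natural multiples of it are separable; hence `0 < m`. -/
theorem IsSepOp.smul {A : Matrix (∀ k, X k) (∀ k, X k) ℂ} (hm : 0 < m) (hA : IsSepOp A) {r : ℝ}
    (hr : 0 ≤ r) : IsSepOp (r • A) := by
  classical
  obtain ⟨n, F, hF, rfl⟩ := hA
  let z : Fin m := ⟨0, hm⟩
  refine ⟨n, fun s k => (if k = z then r else 1) • F s k, fun s k => ?_, ?_⟩
  · exact (hF s k).smul (by split_ifs <;> simp [hr])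
  · rw [Finset.smul_sum]
    refine Finset.sum_congr rfl fun s _ => ?_
    ext a b
    simp only [SeqDisc.prodOp, Matrix.smul_apply, Matrix.of_apply, Complex.real_smul,
      Finset.prod_mul_distrib]
    congr 1
    simp [apply_ite (fun t : ℝ => (t : ℂ))]

end Separable

/-- Announcing a guess gives `0` or `1`; a round conjugates by product operators and adds, and both
operations preserve separability. -/
theorem IsLOCC.isSepOp {m : ℕ} {Ω : Type} [DecidableEq Ω] {X : Fin m → Type} [∀ k, Fintype (X k)]
    [∀ k, DecidableEq (X k)] {M : Ω → Matrix (∀ k, X k) (∀ k, X k) ℂ} (hM : IsLOCC X M) (i : Ω) :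
    IsSepOp (M i) := by
  induction hM with
  | guess X o =>
    dsimp only
    split_ifs
    · exact IsSepOp.one
    · exact IsSepOp.zero
  | round X k r Y B _ _ N _ ih => exact IsSepOp.sum _ fun a _ => (ih a).conj (B a)

/-! ### Computational-basis measurements are LOCC -/

section BasisMeasurement

variable {m : ℕ} {X : Fin m → Type} [∀ k, Fintype (X k)] [∀ k, DecidableEq (X k)]
  {Ω : Type} [DecidableEq Ω]

/-- The measurement of every party in the computational basis, followed by the classical
processing `f` of the results. -/
def basisMeas (f : (∀ k, X k) → Ω) (i : Ω) : Matrix (∀ k, X k) (∀ k, X k) ℂ :=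
  Matrix.diagonal fun x => if f x = i then 1 else 0

theorem basisMeas_eq_sum (f : (∀ k, X k) → Ω) (i : Ω) :
    basisMeas f i = ∑ x with f x = i, prodOp fun k => Matrix.single (x k) (x k) (1 : ℂ) := by
  simp only [prodOp_single, basisMeas]
  ext a b
  simp only [Matrix.sum_apply, Matrix.diagonal_apply]
  by_cases hab : a = b
  · simp [hab, Pi.single_apply, Finset.sum_ite_eq]
  · simp [hab]

theorem isMeasurement_basisMeas [Fintype Ω] (f : (∀ k, X k) → Ω) :
    IsMeasurement (basisMeas f) := by
  refine ⟨fun i => Matrix.PosSemidef.diagonal fun x => ?_, ?_⟩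
  · dsimp only
    split_ifs <;> simp
  · ext a b
    rw [Matrix.sum_apply]
    by_cases hab : a = b
    · subst hab
      simp [basisMeas]
    · simp [hab, basisMeas]

/-- `S` holds the parties still to be measured. Each round measures one of them and fixes its
coordinate in `f`; when `S` is empty, `f` is constant and its value is announced. -/
theorem isLOCC_basisMeas_of_dependsOn [Nonempty (∀ k, X k)] (S : Finset (Fin m))
    (f : (∀ k, X k) → Ω) (hf : ∀ x y, (∀ k ∈ S, x k = y k) → f x = f y) :
    IsLOCC X (basisMeas f) := by
  induction S using Finset.induction_on generalizing f with
  | empty =>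
    obtain ⟨x₀⟩ := ‹Nonempty (∀ k, X k)›
    have h : basisMeas f = fun i => if i = f x₀ then 1 else 0 := by
      funext i
      have hx : ∀ x, f x = f x₀ := fun x => hf x x₀ (by simp)
      simp only [basisMeas, hx, eq_comm (a := i)]
      split_ifs <;> simp
    rw [h]
    exact IsLOCC.guess X (f x₀)
  | insert k S hk ih =>
    let e := (Fintype.equivFin (X k)).symm
    -- Diagonals of the Kraus operators: party `k` projects onto the basis vector `e a`, all others
    -- do nothing.
    let v : ∀ (_ : Fin (Fintype.card (X k))) (j : Fin m), X j → ℂ := fun a j y =>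
      if h : j = k then (if h ▸ y = e a then 1 else 0) else 1
    have hvk : ∀ a (y : X k), v a k y = if y = e a then 1 else 0 := fun a y => by simp [v]
    have hvj : ∀ a j, j ≠ k → v a j = 1 := fun a j hj => by
      funext y
      simp [v, hj]
    have hvv : ∀ a (x : ∀ j, X j), ∏ j, v a j (x j) = if x k = e a then 1 else 0 := fun a x => by
      rw [Finset.prod_eq_single k (fun j _ hj => by rw [hvj a j hj]; rfl) (by simp), hvk]
    have hvs : ∀ a j (y : X j), star (v a j y) = v a j y := fun a j y => by
      simp only [v]
      split_ifs <;> simp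
    have key := IsLOCC.round X k (Fintype.card (X k)) (fun _ => X)
      (fun a j => Matrix.diagonal (v a j))
      (by
        ext y z
        simp only [Matrix.diagonal_conjTranspose, Matrix.diagonal_mul_diagonal, Matrix.sum_apply]
        by_cases hyz : y = z
        · subst hyz
          simp only [Matrix.diagonal_apply_eq, Pi.star_apply, hvk, Matrix.one_apply_eq]
          rw [← Equiv.sum_comp e.symm]
          simp
        · simp [hyz])
      (fun a j hj => by simp [hvj a j hj])
      (fun a => basisMeas fun x => f (Function.update x k (e a)))
      (fun a => ih _ fun x y hxy => hf _ _ fun j hj => by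
        by_cases hjk : j = k
        · subst hjk
          simp
        · simpa [hjk] using hxy j ((Finset.mem_insert.mp hj).resolve_left hjk))
    convert key using 1
    funext i
    simp only [prodOp_diagonal, basisMeas, Matrix.diagonal_conjTranspose,
      Matrix.diagonal_mul_diagonal, Pi.star_apply, hvv]
    ext x y
    rw [Matrix.sum_apply]
    by_cases hxy : x = y
    · subst hxy
      simp only [Matrix.diagonal_apply_eq]
      rw [← Equiv.sum_comp e.symm]
      rw [Finset.sum_eq_single (x k)]
      · simp
      · intro b _ hb
        simp [Ne.symm hb]
      · simp
    · simp [hxy]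

theorem isLOCC_basisMeas [Nonempty (∀ k, X k)] (f : (∀ k, X k) → Ω) : IsLOCC X (basisMeas f) :=
  isLOCC_basisMeas_of_dependsOn Finset.univ f fun _ _ h =>
    congrArg f (funext fun k => h k (Finset.mem_univ k))

end BasisMeasurement

/-! ### Positivity of traces and of substochastic complements -/

theorem trace_mul_nonneg_of_posSemidef {V : Type*} [Fintype V] {A B : Matrix V V ℂ}
    (hA : A.PosSemidef) (hB : B.PosSemidef) : 0 ≤ (A * B).trace := by
  classical
  obtain ⟨C, rfl⟩ : ∃ C : Matrix V V ℂ, A = Cᴴ * C := by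
    open scoped MatrixOrder in
    exact CStarAlgebra.nonneg_iff_eq_star_mul_self.mp hA.nonneg
  rw [Matrix.mul_assoc, Matrix.trace_mul_comm]
  exact (hB.mul_mul_conjTranspose_same C).trace_nonneg

/-- A symmetric matrix with nonnegative entries and row sums at most `1` is at most `1`. -/
theorem posSemidef_one_sub_of_rowSum_le {V : Type*} [Fintype V] [DecidableEq V] (w : V → V → ℝ)
    (hw : ∀ a b, 0 ≤ w a b) (hsymm : ∀ a b, w a b = w b a) (hrow : ∀ a, ∑ b, w a b ≤ 1) :
    (1 - Matrix.of fun a b => (w a b : ℂ)).PosSemidef := by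
  let e : V → V → ℂ := fun a => Pi.single a 1
  let u : V → V → V → ℂ := fun a b => e a - e b
  -- Graph Laplacian: the defects of the row sums on the diagonal, plus `w a b` times the rank-one
  -- form of `e a - e b` for each edge. Ordered pairs count every edge twice, hence the `1 / 2`.
  have key : (1 - Matrix.of fun a b => (w a b : ℂ)) =
      Matrix.diagonal (fun a => ((1 - ∑ b, w a b : ℝ) : ℂ)) +
        ∑ a, ∑ b, (w a b / 2) • Matrix.vecMulVec (u a b) (star (u a b)) := by
    have hstar : ∀ a b, star (u a b) = u a b := fun a b => by
      simp only [u, e, star_sub, ← Pi.single_star, star_one]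
    ext p q
    have hpq : ∑ a, ∑ b, ((w a b : ℂ) / 2) *
        ((e a p - e b p) * (e a q - e b q)) =
        (if p = q then ((∑ b, w p b : ℝ) : ℂ) else 0) - w p q := by
      have hexp : ∀ a b, ((w a b : ℂ) / 2) *
          ((e a p - e b p) * (e a q - e b q)) =
          (if p = a then (if q = a then (w a b : ℂ) / 2 else 0) else 0)
          - (if p = a then (if q = b then (w a b : ℂ) / 2 else 0) else 0)
          - (if q = a then (if p = b then (w a b : ℂ) / 2 else 0) else 0)
          + (if p = b then (if q = b then (w a b : ℂ) / 2 else 0) else 0) := fun a b => by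
        simp only [e, Pi.single_apply]
        split_ifs <;> ring
      simp only [hexp, Finset.sum_add_distrib, Finset.sum_sub_distrib]
      rw [Finset.sum_comm (f := fun a b =>
        if p = b then (if q = b then (w a b : ℂ) / 2 else 0) else 0)]
      simp only [Finset.sum_ite_eq, Finset.mem_univ, if_true, Finset.sum_ite_irrel,
        Finset.sum_const_zero]
      by_cases h : p = q
      · subst h
        have hs : ∀ x, w x p = w p x := fun x => hsymm x p
        simp only [if_true, hs, Complex.ofReal_sum, ← Finset.sum_div]
        ring
      · simp only [h, Ne.symm h, if_false, hsymm q p]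
        ring
    simp only [Matrix.sub_apply, Matrix.add_apply, Matrix.sum_apply, Matrix.smul_apply,
      Matrix.vecMulVec_apply, Matrix.of_apply, hstar]
    simp only [u, Pi.sub_apply, Complex.real_smul, Complex.ofReal_div, Complex.ofReal_ofNat]
    rw [hpq, Matrix.one_apply, Matrix.diagonal_apply]
    split_ifs
    · push_cast
      ring
    · ring
  rw [key]
  refine Matrix.PosSemidef.add (Matrix.PosSemidef.diagonal fun a => ?_)
    (Matrix.posSemidef_sum _ fun a _ => Matrix.posSemidef_sum _ fun b _ =>
      (Matrix.posSemidef_vecMulVec_self_star _).smul (by linarith [hw a b]))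
  exact Complex.zero_le_real.mpr (sub_nonneg.mpr (hrow a))

/-! ### Partial transposition and the substochastic bound -/

section PartialTranspose

variable {m : ℕ} {X : Fin m → Type}

/-- The index `a` with the share of party `k` replaced by that of `b`. -/
def swapAt (k : Fin m) (a b : ∀ j, X j) : ∀ j, X j :=
  fun j => if j = k then b j else a j

/-- The partial transpose with respect to party `k`. -/
def partialTranspose (k : Fin m) (A : Matrix (∀ j, X j) (∀ j, X j) ℂ) :
    Matrix (∀ j, X j) (∀ j, X j) ℂ :=
  Matrix.of fun a b => A (swapAt k a b) (swapAt k b a)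

theorem swapAt_swapAt (k : Fin m) (a b : ∀ j, X j) :
    swapAt k (swapAt k a b) (swapAt k b a) = a := by
  funext j
  simp only [swapAt]
  split_ifs <;> rfl

theorem swapAt_self (k : Fin m) (a : ∀ j, X j) : swapAt k a a = a := by
  funext j
  simp [swapAt]

/-- Exchanging the shares of party `k` in a pair of indices. -/
def swapEquiv (k : Fin m) : (∀ j, X j) × (∀ j, X j) ≃ (∀ j, X j) × (∀ j, X j) where
  toFun p := (swapAt k p.1 p.2, swapAt k p.2 p.1)
  invFun p := (swapAt k p.1 p.2, swapAt k p.2 p.1)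
  left_inv p := by simp [swapAt_swapAt]
  right_inv p := by simp [swapAt_swapAt]

theorem swapAt_eq_swapAt_iff {k : Fin m} {a b : ∀ j, X j} :
    swapAt k a b = swapAt k b a ↔ a = b :=
  ⟨fun h => congrArg Prod.fst ((swapEquiv k).injective (a₁ := (a, b)) (a₂ := (b, a))
    (Prod.ext h h.symm)), fun h => by rw [h]⟩

/-- The trace is a sum over pairs of indices, and partial transposition only permutes these pairs.
-/
theorem trace_partialTranspose_mul [∀ j, Fintype (X j)] (k : Fin m)
    (A B : Matrix (∀ j, X j) (∀ j, X j) ℂ) :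
    (partialTranspose k A * partialTranspose k B).trace = (A * B).trace := by
  simp only [Matrix.trace, Matrix.diag_apply, Matrix.mul_apply]
  rw [← Fintype.sum_prod_type', ← Fintype.sum_prod_type']
  exact Fintype.sum_equiv (swapEquiv k) _ _ fun _ => rfl

theorem partialTranspose_one [∀ j, DecidableEq (X j)] (k : Fin m) :
    partialTranspose k (1 : Matrix (∀ j, X j) (∀ j, X j) ℂ) = 1 := by
  ext a b
  simp only [partialTranspose, Matrix.of_apply, Matrix.one_apply, swapAt_eq_swapAt_iff]

theorem partialTranspose_sum (k : Fin m) {ι : Type*} (s : Finset ι)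
    (A : ι → Matrix (∀ j, X j) (∀ j, X j) ℂ) :
    partialTranspose k (∑ i ∈ s, A i) = ∑ i ∈ s, partialTranspose k (A i) := by
  ext a b
  simp [partialTranspose, Matrix.sum_apply]

theorem partialTranspose_prodOp (k : Fin m) (F : ∀ j, Matrix (X j) (X j) ℂ) :
    partialTranspose k (prodOp F) = prodOp fun j => if j = k then (F j)ᵀ else F j := by
  ext a b
  simp only [partialTranspose, prodOp, Matrix.of_apply, swapAt]
  refine Finset.prod_congr rfl fun j _ => ?_
  split_ifs <;> rfl

/-- The Peres criterion: transposing one local factor keeps it positive semidefinite. -/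
theorem IsSepOp.partialTranspose_posSemidef [∀ j, Fintype (X j)] (k : Fin m)
    {σ : Matrix (∀ j, X j) (∀ j, X j) ℂ} (hσ : IsSepOp σ) :
    (partialTranspose k σ).PosSemidef := by
  obtain ⟨r, F, hF, rfl⟩ := hσ
  rw [partialTranspose_sum]
  refine Matrix.posSemidef_sum _ fun s _ => ?_
  rw [partialTranspose_prodOp]
  refine prodOp_posSemidef _ fun j => ?_
  split_ifs
  · exact (hF s j).transpose
  · exact hF s j

theorem partialTranspose_seqOp {L : ℕ} {X : Fin L → Fin m → Type} (k : Fin m)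
    (A : ∀ l, Matrix (∀ j, X l j) (∀ j, X l j) ℂ) :
    partialTranspose k (seqOp A) = seqOp fun l => partialTranspose k (A l) := by
  ext a b
  simp only [partialTranspose, seqOp, Matrix.of_apply]
  refine Finset.prod_congr rfl fun l _ => ?_
  congr 1 <;> funext j <;> simp only [swapAt] <;> split_ifs <;> rfl

/-- The partial transpose of `A` with respect to party `k` is a symmetric matrix with nonnegative
entries and row sums at most `1`. -/
def IsSubstochasticAt [∀ j, Fintype (X j)] (k : Fin m) (A : Matrix (∀ j, X j) (∀ j, X j) ℂ) :
    Prop :=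
  ∃ w : (∀ j, X j) → (∀ j, X j) → ℝ, (∀ a b, 0 ≤ w a b) ∧ (∀ a b, w a b = w b a) ∧
    (∀ a, ∑ b, w a b ≤ 1) ∧ partialTranspose k A = Matrix.of fun a b => (w a b : ℂ)

theorem IsSubstochasticAt.trace_mul_le [∀ j, Fintype (X j)] {k : Fin m}
    {A σ : Matrix (∀ j, X j) (∀ j, X j) ℂ} (hA : IsSubstochasticAt k A) (hσ : IsSepOp σ) :
    (A * σ).trace ≤ σ.trace := by
  classical
  obtain ⟨w, hw, hsymm, hrow, hwA⟩ := hA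
  have h := trace_mul_nonneg_of_posSemidef (posSemidef_one_sub_of_rowSum_le w hw hsymm hrow)
    (hσ.partialTranspose_posSemidef k)
  rw [← hwA, ← partialTranspose_one k, Matrix.sub_mul, Matrix.trace_sub,
    trace_partialTranspose_mul, trace_partialTranspose_mul, Matrix.one_mul] at h
  exact sub_nonneg.mp h

/-- Row sums of a tensor product are products of row sums. This multiplicativity lets a single-step
check control the whole sequence. -/
theorem IsSubstochasticAt.seqOp {L : ℕ} {X : Fin L → Fin m → Type} [∀ l j, Fintype (X l j)]
    {k : Fin m} {A : ∀ l, Matrix (∀ j, X l j) (∀ j, X l j) ℂ}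
    (hA : ∀ l, IsSubstochasticAt k (A l)) :
    IsSubstochasticAt (X := fun j => ∀ l, X l j) k (seqOp A) := by
  classical
  choose w hw hsymm hrow hwA using hA
  refine ⟨fun a b => ∏ l, w l (fun j => a j l) (fun j => b j l),
    fun a b => Finset.prod_nonneg fun l _ => hw l _ _,
    fun a b => Finset.prod_congr rfl fun l _ => hsymm l _ _, fun a => ?_, ?_⟩
  · have h : ∑ b : ∀ j, ∀ l, X l j, ∏ l, w l (fun j => a j l) (fun j => b j l) =
        ∏ l, ∑ y, w l (fun j => a j l) y := by
      rw [Finset.prod_univ_sum, Fintype.piFinset_univ]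
      exact Fintype.sum_equiv (Equiv.piComm _) _ _ fun _ => rfl
    rw [h]
    exact Finset.prod_le_one (fun l _ => Finset.sum_nonneg fun y _ => hw l _ _)
      fun l _ => hrow l _
  · rw [partialTranspose_seqOp]
    ext a b
    simp only [SeqDisc.seqOp, hwA, Matrix.of_apply, Complex.ofReal_prod]

end PartialTranspose

/-! ### Bounds on success probabilities -/

namespace Ensemble

variable {m : ℕ} {X : Fin m → Type} [∀ k, Fintype (X k)] [∀ k, DecidableEq (X k)]
  {Ω : Type} [Fintype Ω]

/-- Weak duality with dual operator `h • 1`: the traces of the `M i` add up to the dimension. -/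
theorem success_le_of_bound (E : Ensemble X Ω) {h : ℝ}
    (hE : ∀ i σ, IsSepOp σ → E.η i * (E.ρ i * σ).trace.re ≤ h * σ.trace.re)
    {M : Ω → Matrix (∀ k, X k) (∀ k, X k) ℂ} (hM : IsMeasurement M)
    (hsep : ∀ i, IsSepOp (M i)) : E.success M ≤ h * Fintype.card (∀ k, X k) := by
  refine (Finset.sum_le_sum fun i _ => hE i (M i) (hsep i)).trans_eq ?_
  rw [← Finset.mul_sum, ← Complex.re_sum, ← Matrix.trace_sum, hM.2, Matrix.trace_one,
    Complex.natCast_re]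

theorem success_le_one (E : Ensemble X Ω) {M : Ω → Matrix (∀ k, X k) (∀ k, X k) ℂ}
    (hM : IsMeasurement M) : E.success M ≤ 1 := by
  classical
  rw [← E.η_sum]
  refine Finset.sum_le_sum fun i _ => mul_le_of_le_one_right (E.η_pos i).le ?_
  have hc : (1 - M i).PosSemidef := by
    rw [← hM.2, ← Finset.add_sum_erase _ _ (Finset.mem_univ i), add_sub_cancel_left]
    exact Matrix.posSemidef_sum _ fun j _ => hM.1 j
  have h := trace_mul_nonneg_of_posSemidef (E.ρ_posSemidef i) hc
  rw [Matrix.mul_sub, Matrix.mul_one, Matrix.trace_sub, E.ρ_trace] at h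
  simpa using (Complex.le_def.mp h).1

theorem success_le_pG (E : Ensemble X Ω) {M : Ω → Matrix (∀ k, X k) (∀ k, X k) ℂ}
    (hM : IsMeasurement M) : E.success M ≤ E.pG :=
  le_csSup ⟨1, by rintro p ⟨N, hN, rfl⟩; exact E.success_le_one hN⟩ ⟨M, hM, rfl⟩

theorem pSEP_eq_success (E : Ensemble X Ω) {M : Ω → Matrix (∀ k, X k) (∀ k, X k) ℂ}
    (hM : IsMeasurement M) (hsep : ∀ i, IsSepOp (M i))
    (hopt : ∀ N, IsMeasurement N → (∀ i, IsSepOp (N i)) → E.success N ≤ E.success M) :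
    E.pSEP = E.success M :=
  IsGreatest.csSup_eq ⟨⟨M, hM, hsep, rfl⟩, by rintro p ⟨N, hN, hN', rfl⟩; exact hopt N hN hN'⟩

/-- Optimality is only tested against separable measurements, which include all LOCC ones. -/
theorem pL_eq_success [DecidableEq Ω] (E : Ensemble X Ω)
    {M : Ω → Matrix (∀ k, X k) (∀ k, X k) ℂ} (hM : IsMeasurement M) (hlocc : IsLOCC X M)
    (hopt : ∀ N, IsMeasurement N → (∀ i, IsSepOp (N i)) → E.success N ≤ E.success M) :
    E.pL = E.success M :=
  IsGreatest.csSup_eq ⟨⟨M, hM, hlocc, rfl⟩, by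
    rintro p ⟨N, hN, hN', rfl⟩
    exact hopt N hN hN'.isSepOp⟩

end Ensemble

theorem Ensemble.seq_success {m L : ℕ} {X : Fin L → Fin m → Type} [∀ l k, Fintype (X l k)]
    {Ω : Fin L → Type} [∀ l, Fintype (Ω l)] (E : ∀ l, Ensemble (X l) (Ω l))
    {M : ∀ l, Ω l → Matrix (∀ k, X l k) (∀ k, X l k) ℂ} (hM : ∀ l i, (M l i).PosSemidef) :
    (Ensemble.seq E).success (fun c => seqOp fun l => M l (c l)) = ∏ l, (E l).success (M l) := by
  classical
  simp only [success, Ensemble.seq, seqOp_mul, seqOp_trace, Finset.prod_univ_sum,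
    Fintype.piFinset_univ, Finset.prod_mul_distrib]
  refine Finset.sum_congr rfl fun c _ => ?_
  congr 1
  -- Real parts are multiplicative here only because these traces are real.
  have h : ∀ l, ((E l).ρ (c l) * M l (c l)).trace =
      ((((E l).ρ (c l) * M l (c l)).trace.re : ℝ) : ℂ) := fun l =>
    Complex.eq_re_of_ofReal_le
      (r := 0) (by
        simpa using trace_mul_nonneg_of_posSemidef ((E l).ρ_posSemidef (c l)) (hM l (c l)))
  rw [Finset.prod_congr rfl fun l _ => h l, ← Complex.ofReal_prod, Complex.ofReal_re]

/-! ### The measurement of the example as a basis measurement -/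

section Example

variable {m d : ℕ}

/-- The outcome announced after the results `x` of the computational-basis measurements. -/
noncomputable def exLabel (m d : ℕ) (x : Fin m → Fin d) : Fin (d + 2) :=
  if h : ∃ j : Fin d, x = fun _ => j then ⟨h.choose, by omega⟩ else ⟨d, by omega⟩

theorem const_injective (hm : 2 ≤ m) {i j : Fin d} (h : (fun _ : Fin m => i) = fun _ => j) :
    i = j :=
  congrFun h ⟨0, by omega⟩

theorem exLabel_const (hm : 2 ≤ m) (j : Fin d) :
    exLabel m d (fun _ => j) = ⟨j, by omega⟩ := by
  have h : ∃ i : Fin d, (fun _ : Fin m => j) = fun _ => i := ⟨j, rfl⟩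
  rw [exLabel, dif_pos h]
  have hj : h.choose = j := (const_injective hm h.choose_spec).symm
  simp only [hj]

theorem exLabel_of_not_const {x : Fin m → Fin d} (h : ¬ ∃ j : Fin d, x = fun _ => j) :
    exLabel m d x = ⟨d, by omega⟩ := by
  rw [exLabel, dif_neg h]

theorem Psi_eq_diagonal (j : Fin d) :
    Psi m d j = Matrix.diagonal (Pi.single (fun _ => j) 1) := by
  ext x y
  simp only [Psi, diagKet, Matrix.vecMulVec_apply, Pi.star_apply, Pi.single_apply,
    Matrix.diagonal_apply]
  by_cases hxy : x = y
  · subst hxy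
    by_cases hx : x = fun _ => j <;> simp [hx]
  · rw [if_neg hxy]
    by_cases hx : x = fun _ => j
    · have hy : y ≠ fun _ => j := fun hy => hxy (hx.trans hy.symm)
      simp [hy]
    · simp [hx]

/-- The last label is never announced by `exLabel`, matching the zero operator. -/
theorem exMeas_eq_basisMeas (hm : 2 ≤ m) : exMeas m d = basisMeas (exLabel m d) := by
  funext i
  unfold exMeas basisMeas
  split_ifs with h h'
  · rw [Psi_eq_diagonal]
    congr 1
    funext x
    rw [Pi.single_apply]
    refine if_congr ?_ rfl rfl
    constructor
    · rintro rfl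
      rw [exLabel_const hm]
    · intro hx
      by_cases hc : ∃ j : Fin d, x = fun _ => j
      · obtain ⟨j, rfl⟩ := hc
        rw [exLabel_const hm] at hx
        subst hx
        rfl
      · rw [exLabel_of_not_const hc] at hx
        subst hx
        simp at h
  · rw [sum_Psi_eq hm, ← Matrix.diagonal_one, Matrix.diagonal_sub]
    congr 1
    funext x
    have hi : i = ⟨d, by omega⟩ := Fin.ext h'
    by_cases hc : ∃ j : Fin d, x = fun _ => j
    · obtain ⟨j, rfl⟩ := hc
      have hj : j.val ≠ d := j.isLt.ne
      have hc : ∃ i : Fin d, (fun _ : Fin m => j) = fun _ => i := ⟨j, rfl⟩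
      simp [exLabel_const hm, hi, hj, hc]
    · simp [hc, exLabel_of_not_const hc, hi]
  · ext x y
    have hi : exLabel m d x ≠ i := by
      rintro rfl
      by_cases hc : ∃ j : Fin d, x = fun _ => j
      · obtain ⟨j, rfl⟩ := hc
        rw [exLabel_const hm] at h
        exact h j.isLt
      · rw [exLabel_of_not_const hc] at h'
        exact h' rfl
    simp [Matrix.diagonal_apply, hi]

theorem exSeqMeas_eq_basisMeas (hm : 2 ≤ m) (L : ℕ) :
    exSeqMeas m d L = basisMeas (X := fun _ : Fin m => Fin L → Fin d)
      fun x l => exLabel m d fun k => x k l := by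
  funext c
  simp only [exSeqMeas, exMeas_eq_basisMeas hm]
  unfold basisMeas
  rw [seqOp_diagonal]
  congr 1
  funext x
  rw [Fintype.prod_ite_zero]
  simp [funext_iff]

theorem isMeasurement_exMeas (hm : 2 ≤ m) : IsMeasurement (exMeas m d) := by
  rw [exMeas_eq_basisMeas hm]
  exact isMeasurement_basisMeas _

theorem isLOCC_exMeas (hm : 2 ≤ m) (hd : 2 ≤ d) :
    IsLOCC (fun _ : Fin m => Fin d) (exMeas m d) := by
  have : Nonempty (Fin m → Fin d) := ⟨fun _ => ⟨0, by omega⟩⟩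
  rw [exMeas_eq_basisMeas hm]
  exact isLOCC_basisMeas _

theorem isMeasurement_exSeqMeas (hm : 2 ≤ m) (L : ℕ) : IsMeasurement (exSeqMeas m d L) := by
  rw [exSeqMeas_eq_basisMeas hm]
  exact isMeasurement_basisMeas (X := fun _ : Fin m => Fin L → Fin d) _

theorem isLOCC_exSeqMeas (hm : 2 ≤ m) (hd : 2 ≤ d) (L : ℕ) :
    IsLOCC (fun _ : Fin m => Fin L → Fin d) (exSeqMeas m d L) := by
  have : Nonempty (Fin m → Fin L → Fin d) := ⟨fun _ _ => ⟨0, by omega⟩⟩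
  rw [exSeqMeas_eq_basisMeas hm]
  exact isLOCC_basisMeas _

/-! ### The weighted states and the optimality conditions -/

theorem sum_diagKet_apply (hm : 2 ≤ m) (x : Fin m → Fin d) :
    (∑ i, diagKet m d i) x = if ∃ j, x = fun _ => j then 1 else 0 := by
  simp only [Finset.sum_apply, diagKet, Pi.single_apply]
  split_ifs with h
  · obtain ⟨j, rfl⟩ := h
    have hj : ∀ i : Fin d, ((fun _ : Fin m => j) = fun _ => i) ↔ j = i := fun i =>
      ⟨const_injective hm, fun h => by rw [h]⟩
    simp [hj]
  · exact Finset.sum_eq_zero fun i _ => if_neg fun hx => h ⟨i, hx⟩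

theorem Phi_apply (hm : 2 ≤ m) (x y : Fin m → Fin d) :
    Phi m d x y =
      if (∃ j, x = fun _ => j) ∧ ∃ j, y = fun _ => j then ((1 / d : ℝ) : ℂ) else 0 := by
  have hq : (1 / Real.sqrt d) * (1 / Real.sqrt d) = 1 / d := by
    rw [div_mul_div_comm, Real.mul_self_sqrt (by positivity), one_mul]
  rw [Phi, Matrix.vecMulVec_apply, ghzKet, Pi.star_apply, Pi.smul_apply, Pi.smul_apply,
    sum_diagKet_apply hm, sum_diagKet_apply hm, ← hq]
  by_cases hx : ∃ j, x = fun _ => j <;> by_cases hy : ∃ j, y = fun _ => j <;> simp [hx, hy]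

/-- The operators `(d^m + d) η_i ρ_i`. -/
noncomputable def exWeighted (m d : ℕ) (i : Fin (d + 2)) :
    Matrix (Fin m → Fin d) (Fin m → Fin d) ℂ :=
  if i.val ≤ d then exMeas m d i else (d : ℝ) • Phi m d

theorem exProb_smul_exState (hm : 2 ≤ m) (hd : 2 ≤ d) (i : Fin (d + 2)) :
    exProb m d i • exState m d i = (1 / ((d : ℝ) ^ m + d)) • exWeighted m d i := by
  have hlt := lt_pow_of_two_le hm hd
  have hne : (d : ℝ) ^ m - d ≠ 0 := (sub_pos.mpr hlt).ne'
  unfold exProb exState exWeighted exMeas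
  by_cases h : i.val < d
  · simp [h, h.le]
  · by_cases h' : i.val = d
    · simp only [h', lt_irrefl, if_false, dite_false, if_true, le_refl, smul_smul]
      congr 1
      field_simp
    · have h'' : ¬ i.val ≤ d := by omega
      simp only [h, h', h'', if_false, dite_false, smul_smul]
      congr 1
      ring

/-- A diagonal matrix is its own partial transpose, and the entries here are `0` or `1`. -/
theorem isSubstochasticAt_basisMeas {X : Fin m → Type} [∀ k, Fintype (X k)]
    [∀ k, DecidableEq (X k)] {Ω : Type} [DecidableEq Ω] (f : (∀ k, X k) → Ω) (i : Ω)
    (k : Fin m) : IsSubstochasticAt k (basisMeas f i) := by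
  refine ⟨fun a b => if a = b then (if f a = i then 1 else 0) else 0, fun a b => ?_,
    fun a b => ?_, fun a => ?_, ?_⟩
  · dsimp only
    split_ifs <;> simp
  · dsimp only
    by_cases h : a = b
    · rw [h]
    · rw [if_neg h, if_neg (Ne.symm h)]
  · rw [Finset.sum_ite_eq, if_pos (Finset.mem_univ a)]
    split_ifs <;> simp
  · ext a b
    simp only [partialTranspose, basisMeas, Matrix.of_apply]
    by_cases h : a = b
    · subst h
      simp [swapAt_self, apply_ite (fun t : ℝ => (t : ℂ))]
    · have h' : swapAt k a b ≠ swapAt k b a := mt swapAt_eq_swapAt_iff.mp h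
      simp [h, Matrix.diagonal_apply_ne _ h']

/-- Partial transposition turns `|i⋯i⟩⟨j⋯j|` into `|j i⋯i⟩⟨i j⋯j|`, so `d Φ` becomes a partial
permutation matrix; the factor `d` cancels the `1 / d` in `Φ`. -/
theorem isSubstochasticAt_smul_Phi (hm : 2 ≤ m) (hd : 2 ≤ d) :
    IsSubstochasticAt (X := fun _ : Fin m => Fin d) ⟨0, by omega⟩ ((d : ℝ) • Phi m d) := by
  classical
  have hd0 : (d : ℝ) ≠ 0 := by positivity
  let z : Fin m := ⟨0, by omega⟩
  let o : Fin m := ⟨1, by omega⟩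
  have hoz : o ≠ z := by simp [o, z]
  let C : (Fin m → Fin d) → Prop := fun x => ∃ j, x = fun _ => j
  refine ⟨fun a b => if C (swapAt z a b) ∧ C (swapAt z b a) then 1 else 0, fun a b => ?_,
    fun a b => if_congr and_comm rfl rfl, fun a => ?_, ?_⟩
  · dsimp only
    split_ifs <;> simp
  · have hb : ∀ b, C (swapAt z a b) ∧ C (swapAt z b a) →
        b = fun k => if k = z then a o else a z := by
      rintro b ⟨⟨i, hi⟩, ⟨j, hj⟩⟩
      funext k
      have h1 := congrFun hi z
      have h2 := congrFun hi o
      have h3 := congrFun hj z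
      have h4 := congrFun hj k
      simp only [swapAt, if_true, hoz, if_false] at h1 h2 h3
      by_cases hk : k = z
      · rw [if_pos hk, hk, h1, h2]
      · simp only [swapAt, hk, if_false] at h4
        rw [if_neg hk, h3, h4]
    calc ∑ b, (if C (swapAt z a b) ∧ C (swapAt z b a) then (1 : ℝ) else 0)
        ≤ ∑ b, if b = (fun k => if k = z then a o else a z) then (1 : ℝ) else 0 := by
          refine Finset.sum_le_sum fun b _ => ?_
          by_cases h : C (swapAt z a b) ∧ C (swapAt z b a)
          · rw [if_pos h, if_pos (hb b h)]
          · rw [if_neg h]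
            split_ifs <;> simp
      _ ≤ 1 := by simp
  · ext a b
    simp only [partialTranspose, Matrix.of_apply, Matrix.smul_apply, Phi_apply hm]
    change (d : ℝ) • (if C (swapAt z a b) ∧ C (swapAt z b a) then _ else _) = _
    split_ifs
    · rw [Complex.real_smul, ← Complex.ofReal_mul, mul_one_div_cancel hd0]
    · simp

theorem isSubstochasticAt_exWeighted (hm : 2 ≤ m) (hd : 2 ≤ d) (i : Fin (d + 2)) :
    IsSubstochasticAt (X := fun _ : Fin m => Fin d) ⟨0, by omega⟩ (exWeighted m d i) := by
  unfold exWeighted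
  split_ifs
  · rw [exMeas_eq_basisMeas hm]
    exact isSubstochasticAt_basisMeas _ i _
  · exact isSubstochasticAt_smul_Phi hm hd

/-- Complementary slackness for one step: `M_i` is a projector equal to its weighted state, or zero.
-/
theorem exMeas_mul_exWeighted (hm : 2 ≤ m) (i : Fin (d + 2)) :
    exMeas m d i * exWeighted m d i = exMeas m d i := by
  unfold exWeighted
  split_ifs with h
  · rw [exMeas_eq_basisMeas hm, basisMeas, Matrix.diagonal_mul_diagonal]
    simp
  · have h0 : exMeas m d i = 0 := by
      rw [exMeas, dif_neg (by omega), if_neg (by omega)]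
    rw [h0, Matrix.zero_mul]

theorem exSeq_eta_smul_rho (hm : 2 ≤ m) (hd : 2 ≤ d) (L : ℕ) (c : Fin L → Fin (d + 2)) :
    (exSeq m d L hm hd).η c • (exSeq m d L hm hd).ρ c =
      (1 / ((d : ℝ) ^ m + d) ^ L) • seqOp fun l => exWeighted m d (c l) := by
  have h := seqOp_smul (X := fun (_ : Fin L) (_ : Fin m) => Fin d)
    (fun l => exProb m d (c l)) (fun l => exState m d (c l))
  simp only [exProb_smul_exState hm hd, seqOp_smul, Finset.prod_const, Finset.card_univ,
    Fintype.card_fin, one_div_pow] at h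
  exact h.symm

theorem exEnsemble_bound (hm : 2 ≤ m) (hd : 2 ≤ d) (i : Fin (d + 2))
    (σ : Matrix (Fin m → Fin d) (Fin m → Fin d) ℂ) (hσ : IsSepOp (X := fun _ => Fin d) σ) :
    (exEnsemble m d hm hd).η i * ((exEnsemble m d hm hd).ρ i * σ).trace.re ≤
      1 / ((d : ℝ) ^ m + d) * σ.trace.re := by
  have h : (exEnsemble m d hm hd).η i * ((exEnsemble m d hm hd).ρ i * σ).trace.re =
      ((exProb m d i • exState m d i) * σ).trace.re := by
    rw [Matrix.smul_mul, Matrix.trace_smul, Complex.real_smul, Complex.re_ofReal_mul]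
    rfl
  rw [h, exProb_smul_exState hm hd, Matrix.smul_mul, Matrix.trace_smul, Complex.real_smul,
    Complex.re_ofReal_mul]
  exact mul_le_mul_of_nonneg_left
    (Complex.le_def.mp ((isSubstochasticAt_exWeighted hm hd i).trace_mul_le hσ)).1 (by positivity)

theorem trace_seqOp_exWeighted_le (hm : 2 ≤ m) (hd : 2 ≤ d) {L : ℕ} (c : Fin L → Fin (d + 2))
    {σ : Matrix (Fin m → Fin L → Fin d) (Fin m → Fin L → Fin d) ℂ}
    (hσ : IsSepOp (X := fun _ => Fin L → Fin d) σ) :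
    ((seqOp fun l => exWeighted m d (c l)) * σ).trace ≤ σ.trace :=
  (IsSubstochasticAt.seqOp (X := fun (_ : Fin L) (_ : Fin m) => Fin d)
    fun l => isSubstochasticAt_exWeighted hm hd (c l)).trace_mul_le hσ

theorem exSeq_bound (hm : 2 ≤ m) (hd : 2 ≤ d) {L : ℕ} (c : Fin L → Fin (d + 2))
    (σ : Matrix (Fin m → Fin L → Fin d) (Fin m → Fin L → Fin d) ℂ)
    (hσ : IsSepOp (X := fun _ => Fin L → Fin d) σ) :
    (exSeq m d L hm hd).η c * ((exSeq m d L hm hd).ρ c * σ).trace.re ≤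
      1 / ((d : ℝ) ^ m + d) ^ L * σ.trace.re := by
  have h : (exSeq m d L hm hd).η c * ((exSeq m d L hm hd).ρ c * σ).trace.re =
      (((exSeq m d L hm hd).η c • (exSeq m d L hm hd).ρ c) * σ).trace.re := by
    rw [Matrix.smul_mul, Matrix.trace_smul, Complex.real_smul, Complex.re_ofReal_mul]
  rw [h, exSeq_eta_smul_rho, Matrix.smul_mul, Matrix.trace_smul, Complex.real_smul,
    Complex.re_ofReal_mul]
  exact mul_le_mul_of_nonneg_left
    (Complex.le_def.mp (trace_seqOp_exWeighted_le hm hd c hσ)).1 (by positivity)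

theorem exH_eq (L : ℕ) : exH m d L = (1 / ((d : ℝ) ^ m + d) ^ L) • 1 := by
  rw [exH, seqOp_one (X := fun (_ : Fin L) (_ : Fin m) => Fin d)]

theorem exH_isHermitian (L : ℕ) : (exH m d L).IsHermitian := by
  rw [exH_eq]
  exact (Matrix.PosSemidef.one.smul (by positivity)).isHermitian

theorem exH_sub_isBlockPositive (hm : 2 ≤ m) (hd : 2 ≤ d) {L : ℕ} (c : Fin L → Fin (d + 2)) :
    IsBlockPositive (X := fun _ : Fin m => Fin L → Fin d)
      (exH m d L - (exSeq m d L hm hd).η c • (exSeq m d L hm hd).ρ c) := by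
  refine ⟨(exH_isHermitian L).sub
    (((exSeq m d L hm hd).ρ_posSemidef c).smul ((exSeq m d L hm hd).η_pos c).le).isHermitian,
    fun σ hσ _ => ?_⟩
  have h := exSeq_bound hm hd c σ hσ
  rw [exH_eq, Matrix.sub_mul, Matrix.trace_sub, Complex.sub_re, Matrix.smul_mul, Matrix.one_mul,
    Matrix.smul_mul, Matrix.trace_smul, Matrix.trace_smul, Complex.real_smul, Complex.real_smul,
    Complex.re_ofReal_mul, Complex.re_ofReal_mul]
  exact sub_nonneg.mpr h

theorem trace_exSeqMeas_mul_exH_sub (hm : 2 ≤ m) (hd : 2 ≤ d) {L : ℕ}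
    (c : Fin L → Fin (d + 2)) :
    (exSeqMeas m d L c *
      (exH m d L - (exSeq m d L hm hd).η c • (exSeq m d L hm hd).ρ c)).trace = 0 := by
  have h : exSeqMeas m d L c * seqOp (fun l => exWeighted m d (c l)) = exSeqMeas m d L c := by
    rw [exSeqMeas, seqOp_mul (X := fun (_ : Fin L) (_ : Fin m) => Fin d)]
    simp only [exMeas_mul_exWeighted hm]
  rw [exSeq_eta_smul_rho, exH_eq, Matrix.mul_sub, Matrix.mul_smul, Matrix.mul_smul, h,
    Matrix.mul_one, sub_self, Matrix.trace_zero]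

/-! ### Optimal LOCC and separable values -/

theorem success_eq_sum_exWeighted (hm : 2 ≤ m) (hd : 2 ≤ d)
    (N : Fin (d + 2) → Matrix (Fin m → Fin d) (Fin m → Fin d) ℂ) :
    (exEnsemble m d hm hd).success N =
      1 / ((d : ℝ) ^ m + d) * ∑ i, (exWeighted m d i * N i).trace.re := by
  rw [Finset.mul_sum]
  refine Finset.sum_congr rfl fun i _ => ?_
  change exProb m d i * (exState m d i * N i).trace.re = _
  rw [← Complex.re_ofReal_mul, ← Complex.re_ofReal_mul, ← Complex.real_smul, ← Complex.real_smul,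
    ← Matrix.trace_smul, ← Matrix.trace_smul, ← Matrix.smul_mul, ← Matrix.smul_mul,
    exProb_smul_exState hm hd]

theorem success_exMeas (hm : 2 ≤ m) (hd : 2 ≤ d) :
    (exEnsemble m d hm hd).success (exMeas m d) = (d : ℝ) ^ m / ((d : ℝ) ^ m + d) := by
  rw [success_eq_sum_exWeighted]
  simp only [Matrix.trace_mul_comm (exWeighted m d _), exMeas_mul_exWeighted hm]
  rw [← Complex.re_sum, ← Matrix.trace_sum, (isMeasurement_exMeas hm).2, Matrix.trace_one,
    Complex.natCast_re]
  simp [div_eq_inv_mul]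

theorem success_le_of_isSepOp (hm : 2 ≤ m) (hd : 2 ≤ d)
    (N : Fin (d + 2) → Matrix (Fin m → Fin d) (Fin m → Fin d) ℂ) (hN : IsMeasurement N)
    (hsep : ∀ i, IsSepOp (X := fun _ => Fin d) (N i)) :
    (exEnsemble m d hm hd).success N ≤ (exEnsemble m d hm hd).success (exMeas m d) := by
  refine ((exEnsemble m d hm hd).success_le_of_bound (exEnsemble_bound hm hd) hN hsep).trans_eq ?_
  rw [success_exMeas]
  simp [div_eq_inv_mul]

theorem success_exSeqMeas (hm : 2 ≤ m) (hd : 2 ≤ d) (L : ℕ) :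
    (exSeq m d L hm hd).success (exSeqMeas m d L) =
      (exEnsemble m d hm hd).success (exMeas m d) ^ L := by
  have h := Ensemble.seq_success (fun _ : Fin L => exEnsemble m d hm hd)
    (M := fun _ => exMeas m d) fun _ i => (isMeasurement_exMeas hm).1 i
  rw [Finset.prod_const, Finset.card_univ, Fintype.card_fin] at h
  exact h

theorem exSeq_success_le_of_isSepOp (hm : 2 ≤ m) (hd : 2 ≤ d) (L : ℕ)
    (N : (Fin L → Fin (d + 2)) → Matrix (Fin m → Fin L → Fin d) (Fin m → Fin L → Fin d) ℂ)
    (hN : IsMeasurement N) (hsep : ∀ i, IsSepOp (X := fun _ => Fin L → Fin d) (N i)) :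
    (exSeq m d L hm hd).success N ≤ (exSeq m d L hm hd).success (exSeqMeas m d L) := by
  refine ((exSeq m d L hm hd).success_le_of_bound (exSeq_bound hm hd) hN hsep).trans_eq ?_
  rw [success_exSeqMeas, success_exMeas]
  rw [div_pow, one_div_mul_eq_div]
  simp [← pow_mul, mul_comm]

theorem pL_exEnsemble (hm : 2 ≤ m) (hd : 2 ≤ d) :
    (exEnsemble m d hm hd).pL = (exEnsemble m d hm hd).success (exMeas m d) :=
  Ensemble.pL_eq_success _ (isMeasurement_exMeas hm) (isLOCC_exMeas hm hd)
    (success_le_of_isSepOp hm hd)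

theorem pL_exSeq (hm : 2 ≤ m) (hd : 2 ≤ d) (L : ℕ) :
    (exSeq m d L hm hd).pL = (exSeq m d L hm hd).success (exSeqMeas m d L) :=
  Ensemble.pL_eq_success _ (isMeasurement_exSeqMeas hm L) (isLOCC_exSeqMeas hm hd L)
    (exSeq_success_le_of_isSepOp hm hd L)

theorem pSEP_exSeq (hm : 2 ≤ m) (hd : 2 ≤ d) (L : ℕ) :
    (exSeq m d L hm hd).pSEP = (exSeq m d L hm hd).success (exSeqMeas m d L) :=
  Ensemble.pSEP_eq_success _ (isMeasurement_exSeqMeas hm L) (isLOCC_exSeqMeas hm hd L).isSepOp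
    (exSeq_success_le_of_isSepOp hm hd L)

/-! ### Entanglement of the GHZ state and the global advantage -/

theorem Phi_mul_Phi (hm : 2 ≤ m) (hd : 2 ≤ d) : Phi m d * Phi m d = Phi m d := by
  have h := trace_Phi hm hd
  rw [Phi, Matrix.trace_vecMulVec, dotProduct_comm] at h
  rw [Phi, Matrix.vecMulVec_mul_vecMulVec, h, one_smul]

theorem Phi_isHermitian : (Phi m d).IsHermitian :=
  (Matrix.posSemidef_vecMulVec_self_star _).isHermitian

/-- `d Φ` is itself the witness: `Tr (d Φ Φ) = d` exceeds `Tr Φ = 1`. -/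
theorem not_isSepOp_Phi (hm : 2 ≤ m) (hd : 2 ≤ d) :
    ¬ IsSepOp (X := fun _ : Fin m => Fin d) (Phi m d) := by
  intro h
  have h' := (isSubstochasticAt_smul_Phi hm hd).trace_mul_le h
  rw [Matrix.smul_mul, Phi_mul_Phi hm hd, Matrix.trace_smul, trace_Phi hm hd] at h'
  have h2 : (d : ℝ) ≤ 1 := by simpa using (Complex.le_def.mp h').1
  have h3 : (2 : ℝ) ≤ d := by exact_mod_cast hd
  linarith

theorem isSepOp_exState_iff (hm : 2 ≤ m) (hd : 2 ≤ d) (i : Fin (d + 2)) :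
    IsSepOp (X := fun _ : Fin m => Fin d) (exState m d i) ↔ i.val ≤ d := by
  have hlt := lt_pow_of_two_le hm hd
  constructor
  · intro h
    by_contra hi
    rw [exState, dif_neg (by omega), if_neg (by omega)] at h
    exact not_isSepOp_Phi hm hd h
  · intro hi
    -- The first `d + 1` states are nonnegative multiples of LOCC measurement operators.
    have hM := (isLOCC_exMeas hm hd).isSepOp i
    unfold exMeas at hM
    unfold exState
    split_ifs at hM ⊢ with h1 h2
    · exact hM
    · exact hM.smul (by omega) (one_div_nonneg.mpr (by linarith))
    · omega

/-- A global measurement that is better than every LOCC measurement. -/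
noncomputable def exGlobalMeas (m d : ℕ) (i : Fin (d + 2)) :
    Matrix (Fin m → Fin d) (Fin m → Fin d) ℂ :=
  if i.val = 0 then ∑ j, Psi m d j - Phi m d
  else if i.val < d then 0
  else if i.val = d then 1 - ∑ j, Psi m d j
  else Phi m d

theorem sum_Psi_mul_Phi (hm : 2 ≤ m) : (∑ j, Psi m d j) * Phi m d = Phi m d := by
  rw [sum_Psi_eq hm]
  ext x y
  rw [Matrix.diagonal_mul, Phi_apply hm]
  by_cases hx : ∃ j, x = fun _ => j <;> simp [hx]

theorem sum_Psi_mul_sum_Psi (hm : 2 ≤ m) :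
    (∑ j, Psi m d j) * ∑ j, Psi m d j = ∑ j, Psi m d j := by
  rw [sum_Psi_eq hm, Matrix.diagonal_mul_diagonal]
  simp

theorem sum_Psi_isHermitian : (∑ j, Psi m d j).IsHermitian :=
  (Matrix.posSemidef_sum _ fun _ _ => Matrix.posSemidef_vecMulVec_self_star _).isHermitian

/-- `Φ` is a subprojector of `∑ Ψ_j`, so the difference is a projector. -/
theorem posSemidef_sum_Psi_sub_Phi (hm : 2 ≤ m) (hd : 2 ≤ d) :
    (∑ j, Psi m d j - Phi m d).PosSemidef := by
  have hH : (∑ j, Psi m d j - Phi m d)ᴴ = ∑ j, Psi m d j - Phi m d :=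
    sum_Psi_isHermitian.sub Phi_isHermitian
  have hΦ : Phi m d * ∑ j, Psi m d j = Phi m d := by
    have h := congrArg Matrix.conjTranspose (sum_Psi_mul_Phi (d := d) hm)
    rwa [Matrix.conjTranspose_mul, Phi_isHermitian.eq, sum_Psi_isHermitian.eq] at h
  have h : ∑ j, Psi m d j - Phi m d =
      (∑ j, Psi m d j - Phi m d)ᴴ * (∑ j, Psi m d j - Phi m d) := by
    rw [hH, Matrix.sub_mul, Matrix.mul_sub, Matrix.mul_sub, sum_Psi_mul_sum_Psi hm,
      sum_Psi_mul_Phi hm, hΦ, Phi_mul_Phi hm hd, sub_self, sub_zero]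
  rw [h]
  exact Matrix.posSemidef_conjTranspose_mul_self _

theorem isMeasurement_exGlobalMeas (hm : 2 ≤ m) (hd : 2 ≤ d) :
    IsMeasurement (exGlobalMeas m d) := by
  refine ⟨fun i => ?_, ?_⟩
  · unfold exGlobalMeas
    split_ifs
    · exact posSemidef_sum_Psi_sub_Phi hm hd
    · exact Matrix.PosSemidef.zero
    · exact posSemidef_complement hm
    · exact Matrix.posSemidef_vecMulVec_self_star _
  · obtain ⟨n, rfl⟩ : ∃ n, d = n + 1 := ⟨d - 1, by omega⟩
    rw [Fin.sum_univ_castSucc, Fin.sum_univ_castSucc, Fin.sum_univ_succ]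
    simp [exGlobalMeas]

theorem success_lt_success_exGlobalMeas (hm : 2 ≤ m) (hd : 2 ≤ d) :
    (exEnsemble m d hm hd).success (exMeas m d) <
      (exEnsemble m d hm hd).success (exGlobalMeas m d) := by
  have hd2 : (2 : ℝ) ≤ d := by exact_mod_cast hd
  -- Contributions of label `0`, of the complement and of `Φ`. The total exceeds the LOCC value
  -- `d^m` by `1 - 1 / d`.
  have hsum : ∑ i, (exWeighted m d i * exGlobalMeas m d i).trace.re =
      (1 - 1 / d) + ((d : ℝ) ^ m - d) + d := by
    have hQ : ((1 - ∑ j, Psi m d j) * (1 - ∑ j, Psi m d j)).trace =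
        (((d : ℝ) ^ m - d : ℝ) : ℂ) := by
      rw [Matrix.sub_mul, Matrix.one_mul, Matrix.mul_sub, Matrix.mul_one,
        sum_Psi_mul_sum_Psi hm, sub_self, sub_zero, trace_complement]
    have hΨ : ∀ i : Fin d, (Psi m d i * (∑ j, Psi m d j - Phi m d)).trace.re = 1 - 1 / d := by
      intro i
      rw [Psi_eq_diagonal, sum_Psi_eq hm, Matrix.trace]
      simp only [Matrix.diag_apply, Matrix.diagonal_mul, Pi.single_apply, ite_mul, one_mul,
        zero_mul, Finset.sum_ite_eq', Finset.mem_univ, if_true, Matrix.sub_apply,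
        Matrix.diagonal_apply_eq, Phi_apply hm]
      have hc : ∃ j : Fin d, (fun _ : Fin m => i) = fun _ => j := ⟨i, rfl⟩
      simp [hc]
    have hΦ : (((d : ℝ) • Phi m d) * Phi m d).trace.re = d := by
      rw [Matrix.smul_mul, Phi_mul_Phi hm hd, Matrix.trace_smul, trace_Phi hm hd]
      simp
    have hterm : ∀ i : Fin (d + 2), (exWeighted m d i * exGlobalMeas m d i).trace.re =
        if i.val = 0 then 1 - 1 / (d : ℝ) else if i.val < d then 0
        else if i.val = d then (d : ℝ) ^ m - d else d := by
      intro i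
      by_cases h0 : i.val = 0
      · rw [if_pos h0, exWeighted, if_pos (by omega), exMeas, dif_pos (by omega), exGlobalMeas,
          if_pos h0, hΨ]
      by_cases h1 : i.val < d
      · rw [if_neg h0, if_pos h1, exGlobalMeas, if_neg h0, if_pos h1, Matrix.mul_zero,
          Matrix.trace_zero, Complex.zero_re]
      by_cases h2 : i.val = d
      · rw [if_neg h0, if_neg h1, if_pos h2, exWeighted, if_pos h2.le, exMeas, dif_neg h1,
          if_pos h2, exGlobalMeas, if_neg h0, if_neg h1, if_pos h2, hQ, Complex.ofReal_re]
      · rw [if_neg h0, if_neg h1, if_neg h2, exWeighted, if_neg (by omega), exGlobalMeas,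
          if_neg h0, if_neg h1, if_neg h2, hΦ]
    simp only [hterm]
    obtain ⟨n, rfl⟩ : ∃ n, d = n + 1 := ⟨d - 1, by omega⟩
    rw [Fin.sum_univ_castSucc, Fin.sum_univ_castSucc, Fin.sum_univ_succ]
    simp
  rw [success_exMeas, success_eq_sum_exWeighted, hsum, one_div_mul_eq_div]
  refine div_lt_div_of_pos_right ?_ (by positivity)
  have : 1 / (d : ℝ) < 1 := by
    rw [div_lt_one (by linarith)]
    linarith
  linarith

theorem exProb_lt (hm : 2 ≤ m) (hd : 2 ≤ d) (i : Fin (d + 2)) :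
    exProb m d i < (d : ℝ) ^ m / ((d : ℝ) ^ m + d) := by
  have hlt := lt_pow_of_two_le hm hd
  have hd2 : (2 : ℝ) ≤ d := by exact_mod_cast hd
  unfold exProb
  split_ifs <;> exact div_lt_div_of_pos_right (by linarith) (by positivity)

end Example

end SeqDisc

theorem mainTheorem8 (m d L : ℕ) (hm : 2 ≤ m) (hd : 2 ≤ d) (hL : 2 ≤ L) :
    -- the first `d + 1` states are separable, the last one is entangled
    (∀ i : Fin (d + 2), IsSepOp ((exEnsemble m d hm hd).ρ i) ↔ i.val ≤ d) ∧
    -- the measurement of a single step consists of computational-basis measurements of the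
    -- parties, followed by classical processing of the results
    (∃ f : (Fin m → Fin d) → Fin (d + 2), ∀ i : Fin (d + 2),
      exMeas m d i = ∑ x with f x = i,
        prodOp (X := fun _ => Fin d) (Y := fun _ => Fin d)
          fun k => Matrix.single (x k) (x k) 1) ∧
    -- it is an LOCC measurement, and so is its independent repetition
    (IsMeasurement (exMeas m d) ∧ IsLOCC (fun _ : Fin m => Fin d) (exMeas m d)) ∧
    (IsMeasurement (exSeqMeas m d L) ∧
      IsLOCC (fun _ : Fin m => Fin L → Fin d) (exSeqMeas m d L)) ∧
    -- optimality conditions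
    (exH m d L).IsHermitian ∧
    (∀ c : Fin L → Fin (d + 2),
      IsBlockPositive (X := fun _ : Fin m => Fin L → Fin d)
        (exH m d L - (exSeq m d L hm hd).η c • (exSeq m d L hm hd).ρ c) ∧
      (exSeqMeas m d L c *
        (exH m d L - (exSeq m d L hm hd).η c • (exSeq m d L hm hd).ρ c)).trace = 0) ∧
    -- the optimal LOCC discrimination is factorizable, and optimal among separable measurements
    Factorizable (fun _ : Fin L => exEnsemble m d hm hd) ∧
    (exSeq m d L hm hd).pL = (exSeq m d L hm hd).pSEP ∧
    -- the measurements above attain the optimal LOCC success probabilities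
    (exEnsemble m d hm hd).success (exMeas m d) = (exEnsemble m d hm hd).pL ∧
    (exSeq m d L hm hd).success (exSeqMeas m d L) = (exSeq m d L hm hd).pL ∧
    -- a single step
    (exEnsemble m d hm hd).pL = (d : ℝ) ^ m / ((d : ℝ) ^ m + d) ∧
    iSup (exEnsemble m d hm hd).η < (exEnsemble m d hm hd).pL ∧
    (exEnsemble m d hm hd).pL < (exEnsemble m d hm hd).pG ∧
    -- the sequence
    iSup (exSeq m d L hm hd).η < (exSeq m d L hm hd).pL ∧
    (exSeq m d L hm hd).pL < (exSeq m d L hm hd).pG := by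
  have hsucc := success_lt_success_exGlobalMeas hm hd
  have hval := success_exMeas hm hd
  have : Nonempty (Fin L) := ⟨⟨0, by omega⟩⟩
  refine ⟨isSepOp_exState_iff hm hd, ⟨exLabel m d, fun i => ?_⟩,
    ⟨isMeasurement_exMeas hm, isLOCC_exMeas hm hd⟩,
    ⟨isMeasurement_exSeqMeas hm L, isLOCC_exSeqMeas hm hd L⟩, exH_isHermitian L,
    fun c => ⟨exH_sub_isBlockPositive hm hd c, trace_exSeqMeas_mul_exH_sub hm hd c⟩, ?_, ?_,
    (pL_exEnsemble hm hd).symm, (pL_exSeq hm hd L).symm, ?_, ?_, ?_, ?_, ?_⟩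
  · rw [exMeas_eq_basisMeas hm]
    exact basisMeas_eq_sum _ i
  · rw [Factorizable, Finset.prod_const, Finset.card_univ, Fintype.card_fin, pL_exEnsemble hm hd,
      ← success_exSeqMeas hm hd L]
    exact pL_exSeq hm hd L
  · rw [pL_exSeq, pSEP_exSeq]
  · rw [pL_exEnsemble, hval]
  · obtain ⟨i, hi⟩ := exists_eq_ciSup_of_finite (f := (exEnsemble m d hm hd).η)
    rw [← hi, pL_exEnsemble, hval]
    exact exProb_lt hm hd i
  · rw [pL_exEnsemble]
    exact hsucc.trans_le (Ensemble.success_le_pG _ (isMeasurement_exGlobalMeas hm hd))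
  · obtain ⟨c, hc⟩ := exists_eq_ciSup_of_finite (f := (exSeq m d L hm hd).η)
    rw [← hc, pL_exSeq, success_exSeqMeas, hval]
    -- Each factor of the prior is strictly below the single-step optimum; strictness of the product
    -- needs at least one step.
    have h := Finset.prod_lt_prod_of_nonempty (s := (Finset.univ : Finset (Fin L)))
      (fun l _ => (exEnsemble m d hm hd).η_pos (c l)) (fun l _ => exProb_lt hm hd (c l))
      Finset.univ_nonempty
    rw [Finset.prod_const, Finset.card_univ, Fintype.card_fin] at h
    exact h
  -- Repeating the better global measurement raises the strict single-step gap to the power `L`.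
  · have hG := isMeasurement_exGlobalMeas hm hd
    have h := Ensemble.seq_success (fun _ : Fin L => exEnsemble m d hm hd)
      (M := fun _ => exGlobalMeas m d) fun _ i => hG.1 i
    rw [Finset.prod_const, Finset.card_univ, Fintype.card_fin] at h
    rw [pL_exSeq, success_exSeqMeas]
    refine (pow_lt_pow_left₀ hsucc (by rw [hval]; positivity) (by omega)).trans_le ?_
    rw [← h]
    exact Ensemble.success_le_pG _
      (IsMeasurement.seq (X := fun (_ : Fin L) (_ : Fin m) => Fin d) fun _ => hG)
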